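/- **Theorem 1.** For $n\in\mathbb N$ let $S_n(132)$ be the set of permutations $\sigma=\sigma_1\cdots\sigma_n$ of $[n]=\{1,\dots,n\}$ that avoid the pattern $132$, i.e. for which there are no indices $i_1<i_2<i_3$ with $\sigma_{i_1}<\sigma_{i_3}<\sigma_{i_2}$, and let $E_n^{\mathrm{av}(132)}$ denote expectation with respect to the uniform probability measure on $S_n(132)$. For a subsequence $\sigma_{i_1},\dots,\sigma_{i_m}$ ($i_1<\cdots<i_m$, $m\ge 2$), define its up/down sequence $V_1\cdots V_{m-1}$ by $V_j=U$ if $\sigma_{i_{j+1}}>\sigma_{i_j}$ and $V_j=D$ if $\sigma_{i_{j+1}}<\sigma_{i_j}$. Let $L_n^{U^2D}(\sigma)$ be the largest length of a subsequence of $\sigma$ whose up/down sequence is $UUD\,UUD\cdots UUD$, consisting of one or more complete copies of $UUD$; if $\sigma$ has no such subsequence, put $L_n^{U^2D}(\sigma)=0$. (So $L_n^{U^2D}(\sigma)$ is either equal to $0$ or to $3k+1$ for some integer $k\ge 1$.) Then $$E_n^{\mathrm{av}(132)}L_n^{U^2D}\sim \tfrac37\,n \qquad (n\to\infty),$$ that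 is, $\lim_{n\to\infty} \frac{1}{n}\,E_n^{\mathrm{av}(132)}L_n^{U^2D}=\frac37$. -/

import Mathlib

open Filter Asymptotics

/-- The two possible directions of a step: up or down. -/
inductive UpDown : Type
  | U : UpDown
  | D : UpDown

/-- The step from the value `a` to the value `b` goes in the direction `v`. -/
def UpDown.Step {α : Type*} [LT α] (v : UpDown) (a b : α) : Prop :=
  match v with
  | UpDown.U => a < b
  | UpDown.D => b < a

/-- `σ` contains `τ` as a pattern: some subsequence of `σ` is ordered like `τ`. -/
def ContainsPattern {m n : ℕ} (σ : Equiv.Perm (Fin n)) (τ : Equiv.Perm (Fin m)) : Prop :=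
  ∃ i : Fin m ↪o Fin n, ∀ j k : Fin m, σ (i j) < σ (i k) ↔ τ j < τ k

/-- `σ` avoids `τ`. -/
def AvoidsPattern {m n : ℕ} (σ : Equiv.Perm (Fin n)) (τ : Equiv.Perm (Fin m)) : Prop :=
  ¬ ContainsPattern σ τ

/-- The pattern 132, written with the values 0, 1, 2 as `0 ↦ 0, 1 ↦ 2, 2 ↦ 1`. -/
def pattern132 : Equiv.Perm (Fin 3) := Equiv.swap 1 2

/-- The up/down pattern `UUD`. -/
def patternUUD : Fin 3 → UpDown := ![UpDown.U, UpDown.U, UpDown.D]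

/-- The subsequence of `σ` at the positions `i 0 < i 1 < ⋯ < i (k * l)`, which has
`k * l + 1` terms, has the up/down sequence `V₁ ⋯ V_l V₁ ⋯ V_l ⋯ V₁ ⋯ V_l` (`k` blocks). -/
def RepeatsPattern {l n : ℕ} [NeZero l] (V : Fin l → UpDown) (σ : Equiv.Perm (Fin n))
    (k : ℕ) (i : Fin (k * l + 1) ↪o Fin n) : Prop :=
  ∀ j : Fin (k * l), (V (Fin.ofNat l j)).Step (σ (i j.castSucc)) (σ (i j.succ))

/-- The length of a longest subsequence of `σ` that repeats the up/down pattern `V`. Only complete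
repetitions count, and at least one of them is needed; if there is no such subsequence, then the
value is `0` (the supremum of the empty set of natural numbers). -/
noncomputable def longestRepeat {l n : ℕ} [NeZero l] (V : Fin l → UpDown)
    (σ : Equiv.Perm (Fin n)) : ℕ :=
  sSup {m : ℕ | ∃ k : ℕ, 1 ≤ k ∧ m = k * l + 1 ∧
    ∃ i : Fin (k * l + 1) ↪o Fin n, RepeatsPattern V σ k i}

open Classical in
/-- The set of permutations of `n` letters that avoid `τ`. -/
noncomputable def avoiders {m : ℕ} (n : ℕ) (τ : Equiv.Perm (Fin m)) :
    Finset (Equiv.Perm (Fin n)) :=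
  Finset.univ.filter fun σ => AvoidsPattern σ τ

/-- The expectation of `X` under the uniform probability measure on the permutations of
`n` letters that avoid `τ`. -/
noncomputable def avoidersExpectation {m n : ℕ} (τ : Equiv.Perm (Fin m))
    (X : Equiv.Perm (Fin n) → ℝ) : ℝ :=
  (∑ σ ∈ avoiders n τ, X σ) / ((avoiders n τ).card : ℝ)

/-! A 132-avoiding permutation is `A n B` with every letter of `A` above every letter of `B`, so
these permutations are the binary trees. Let `M` be the length of a longest subsequence whose steps
form a prefix of `UUDUUD⋯`. A passage from `A n` to `B` is a descent, possible only after complete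
triples of letters, and the pattern then restarts; hence `M` satisfies a recursion on trees. It
makes `M / 3` additive over the two subtrees, plus a toll of 1 when the left subtree has `M % 3 = 2`
(`maxPrefix_node_div_three`), and the required length differs from `3 * (M / 3)` by at most 3.

The mean of an additive functional is `n` times the mean toll over the left subtree of a random node
of a random tree. In the limit that left subtree has size `i` with probability `catalan i / 4 ^ i /
2` (`tendsto_mean_of_additive`). Only the generating function at 1/4 of the trees with `M % 3 = 2`
remains; root decompositions give linear equations with solution 2/7. The slope is thus 3 · (2/7)/2
= 3/7. -/

open scoped List

/-! ### Binary trees and their words -/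

namespace BinaryTree

/-- The word, on the letters `k, …, k + t.numNodes - 1`, of the 132-avoiding permutation whose
decreasing binary tree is `t`. -/
def permWord : BinaryTree Unit → ℕ → List ℕ
  | nil, _ => []
  | node _ l r, k =>
    permWord l (k + r.numNodes) ++ (k + l.numNodes + r.numNodes) :: permWord r k

/-- The greatest length of a subsequence of the word of `t` whose up/down sequence is a prefix of
`UUDUUD⋯`. -/
def maxPrefix : BinaryTree Unit → ℕ
  | nil => 0
  | node _ l r =>
    let a := if maxPrefix l % 3 = 0 ∧ maxPrefix l ≠ 0 then maxPrefix l else maxPrefix l + 1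
    max a (a / 3 * 3 + maxPrefix r)

lemma length_permWord (t : BinaryTree Unit) (k : ℕ) : (permWord t k).length = t.numNodes := by
  induction t generalizing k with
  | nil => rfl
  | node _ l r hl hr => simp [permWord, hl, hr]; omega

lemma mem_permWord {t : BinaryTree Unit} {k x : ℕ} :
    x ∈ permWord t k ↔ k ≤ x ∧ x < k + t.numNodes := by
  induction t generalizing k with
  | nil => simp [permWord]
  | node _ l r hl hr => simp only [permWord, List.mem_append, List.mem_cons, hl, hr, numNodes]; omega

lemma nodup_permWord (t : BinaryTree Unit) (k : ℕ) : (permWord t k).Nodup := by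
  induction t generalizing k with
  | nil => simp [permWord]
  | node _ l r hl hr =>
    simp only [permWord, List.nodup_append, List.nodup_cons, hl, hr, List.mem_cons, mem_permWord]
    refine ⟨trivial, ⟨by omega, trivial⟩, fun a ha b hb => by omega⟩

lemma permWord_injective {t t' : BinaryTree Unit} {k : ℕ} (h : permWord t k = permWord t' k) :
    t = t' := by
  induction t generalizing k t' with
  | nil =>
    cases t' with
    | nil => rfl
    | node => simp [permWord] at h
  | node a l r hl hr =>
    cases t' with
    | nil => simp [permWord] at h
    | node a' l' r' =>
      have hn := congrArg List.length h
      simp only [length_permWord, numNodes] at hn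
      simp only [permWord] at h
      have hv : k + l'.numNodes + r'.numNodes = k + l.numNodes + r.numNodes := by omega
      rw [hv] at h
      obtain ⟨h1, -, h2⟩ := (List.append_cons_inj_of_notMem (by rw [mem_permWord]; omega)
        (by rw [mem_permWord]; omega)).1 h
      obtain rfl := hr h2
      rw [hl h1]

end BinaryTree

/-! ### Patterns in lists -/

/-- The list `l` has no subsequence ordered like `132`. -/
def List.Avoids132 (l : List ℕ) : Prop :=
  ∀ a b c, [a, b, c] <+ l → ¬ (a < c ∧ c < b)

/-- The up/down sequence of the list is the factor of `UUDUUD⋯` that starts at position `p`. -/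
def List.FollowsUUD : ℕ → List ℕ → Prop
  | _, [] => True
  | _, [_] => True
  | p, x :: y :: s => (if p % 3 = 2 then y < x else x < y) ∧ List.FollowsUUD (p + 1) (y :: s)

namespace List

/-- For nonempty `s` the joining step has index `p + s.length - 1`, which is a `D` exactly when `p +
s.length` is divisible by 3. -/
lemma followsUUD_append {p : ℕ} {s s' : List ℕ} :
    (s ++ s').FollowsUUD p ↔ s.FollowsUUD p ∧ s'.FollowsUUD (p + s.length) ∧
      ∀ x ∈ s.getLast?, ∀ y ∈ s'.head?, if (p + s.length) % 3 = 0 then y < x else x < y := by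
  induction s generalizing p with
  | nil => simp [FollowsUUD]
  | cons x s ih =>
    cases s with
    | nil =>
      cases s' with
      | nil => simp [FollowsUUD]
      | cons y s' =>
        have : (p + 1) % 3 = 0 ↔ p % 3 = 2 := by omega
        simp [FollowsUUD, this, and_comm]
    | cons y s =>
      have e : p + 1 + (y :: s).length = p + (x :: y :: s).length := by simp; omega
      simp only [cons_append, FollowsUUD] at ih ⊢
      rw [ih, e]
      simp [and_assoc]

lemma followsUUD_add {p q : ℕ} (hq : q % 3 = 0) {s : List ℕ} :
    s.FollowsUUD (p + q) ↔ s.FollowsUUD p := by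
  induction s generalizing p with
  | nil => simp [FollowsUUD]
  | cons x s ih =>
    cases s with
    | nil => simp [FollowsUUD]
    | cons y s =>
      have : (p + q) % 3 = p % 3 := by omega
      rw [FollowsUUD, FollowsUUD, this, add_right_comm, ih]

lemma followsUUD_iff_getElem {p : ℕ} {s : List ℕ} :
    s.FollowsUUD p ↔ ∀ (j : ℕ) (h : j + 1 < s.length),
      if (p + j) % 3 = 2 then s[j + 1] < s[j] else s[j] < s[j + 1] := by
  induction s generalizing p with
  | nil => simp [FollowsUUD]
  | cons x s ih =>
    cases s with
    | nil => simp [FollowsUUD]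
    | cons y s =>
      rw [FollowsUUD, ih]
      constructor
      · rintro ⟨h0, h⟩ (_ | j) hj
        · simpa using h0
        · have := h j (by simpa using hj)
          rw [add_right_comm] at this
          simpa [add_assoc] using this
      · intro h
        refine ⟨by simpa using h 0 (by simp), fun j hj => ?_⟩
        have := h (j + 1) (by simpa using hj)
        rw [add_right_comm]
        simpa [add_assoc] using this

lemma FollowsUUD.take {p : ℕ} {s : List ℕ} (h : s.FollowsUUD p) (m : ℕ) :
    (s.take m).FollowsUUD p := by
  rw [← take_append_drop m s, followsUUD_append] at h
  exact h.1

end List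

/-! ### Correctness of the recursion for the longest prefix -/

namespace BinaryTree

/-- Cut the subsequence after the root letter. That letter can only be reached by an ascent, so it
cannot follow a positive multiple of 3 letters. A nonempty first piece is left by a descent, so its
length is a multiple of 3 and the second piece starts the pattern afresh. -/
lemma length_le_maxPrefix {t : BinaryTree Unit} {k : ℕ} {s : List ℕ} (hs : s <+ permWord t k)
    (h : s.FollowsUUD 0) : s.length ≤ maxPrefix t := by
  induction t generalizing k s with
  | nil => simp_all [permWord]
  | node _ l r hl hr =>
    simp only [maxPrefix]
    set a := if maxPrefix l % 3 = 0 ∧ maxPrefix l ≠ 0 then maxPrefix l else maxPrefix l + 1 with ha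
    rw [permWord, List.append_cons, List.sublist_append_iff] at hs
    obtain ⟨u, s₃, rfl, hu, hs₃⟩ := hs
    rw [List.followsUUD_append, zero_add] at h
    obtain ⟨h1, h3, hstep⟩ := h
    have hua : u.length ≤ a := by
      rw [List.sublist_append_iff] at hu
      obtain ⟨s₁, s₂, rfl, hs₁, hs₂⟩ := hu
      rw [List.followsUUD_append, zero_add] at h1
      have h1l := hl hs₁ h1.1
      rw [List.sublist_singleton] at hs₂
      rcases hs₂ with rfl | rfl
      · simp only [List.append_nil]
        split_ifs at ha <;> omega
      · simp only [List.length_append, List.length_singleton]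
        rcases List.eq_nil_or_concat' s₁ with rfl | ⟨s₀, x, rfl⟩
        · split_ifs at ha <;> simp <;> omega
        · have hx := h1.2.2 x (by simp) _ rfl
          have hxl := mem_permWord.1 (hs₁.subset (by simp : x ∈ s₀ ++ [x]))
          split_ifs at hx
          · omega
          · simp only [List.length_append, List.length_singleton] at *
            split_ifs at ha <;> omega
    rcases s₃ with _ | ⟨y, s₃⟩
    · simp; omega
    rcases List.eq_nil_or_concat' u with rfl | ⟨u, x, rfl⟩
    · have := hr hs₃ (by simpa using h3)
      simp at this ⊢; omega
    have hx := hstep x (by simp) y rfl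
    have hyr := mem_permWord.1 (hs₃.subset (by simp : y ∈ y :: s₃))
    have hxl := hu.subset (by simp : x ∈ u ++ [x])
    simp only [List.mem_append, mem_permWord, List.mem_singleton] at hxl
    split_ifs at hx with h0
    · rw [← zero_add (List.length _), List.followsUUD_add h0] at h3
      have := hr hs₃ h3
      rw [List.length_append]
      omega
    · omega

lemma exists_sublist_length_eq_maxPrefix (t : BinaryTree Unit) (k : ℕ) :
    ∃ s, s <+ permWord t k ∧ s.FollowsUUD 0 ∧ s.length = maxPrefix t := by
  induction t generalizing k with
  | nil => exact ⟨[], by simp [List.FollowsUUD, maxPrefix]⟩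
  | node _ l r hl hr =>
    simp only [permWord, maxPrefix]
    set a := if maxPrefix l % 3 = 0 ∧ maxPrefix l ≠ 0 then maxPrefix l else maxPrefix l + 1 with ha
    rw [List.append_cons]
    obtain ⟨s₁, hs₁, h1, hl1⟩ := hl (k + r.numNodes)
    obtain ⟨s₃, hs₃, h3, hl3⟩ := hr k
    have hu : ∃ u, u <+ permWord l (k + r.numNodes) ++ [k + l.numNodes + r.numNodes] ∧
        u.FollowsUUD 0 ∧ u.length = a := by
      split_ifs at ha with hc
      · exact ⟨s₁, hs₁.trans (List.sublist_append_left _ _), h1, by omega⟩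
      · refine ⟨s₁ ++ [k + l.numNodes + r.numNodes], hs₁.append_right _, ?_, by simp; omega⟩
        rw [List.followsUUD_append]
        refine ⟨h1, trivial, fun x hx y hy => ?_⟩
        have hxm := List.mem_of_mem_getLast? hx
        have hxl := mem_permWord.1 (hs₁.subset hxm)
        have := List.length_pos_of_mem hxm
        simp only [List.head?_cons, Option.mem_def, Option.some.injEq] at hy
        split_ifs <;> omega
    obtain ⟨u, hus, hu, hul⟩ := hu
    rcases le_total a (a / 3 * 3 + maxPrefix r) with hm | hm
    -- Discarding the incomplete triple makes the next step a `D`, which any passage to the right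
    -- subtree realises.
    · refine ⟨u.take (a / 3 * 3) ++ s₃, ((List.take_sublist _ _).trans hus).append hs₃, ?_, ?_⟩
      · have hlen : (u.take (a / 3 * 3)).length = a / 3 * 3 := by simp; omega
        rw [List.followsUUD_append, hlen, List.followsUUD_add (by omega)]
        refine ⟨hu.take _, h3, fun x hx y hy => ?_⟩
        rw [if_pos (by omega)]
        have hxl := hus.subset ((List.take_sublist _ _).subset (List.mem_of_mem_getLast? hx))
        simp only [List.mem_append, mem_permWord, List.mem_singleton] at hxl
        have hyr := mem_permWord.1 (hs₃.subset (List.mem_of_mem_head? hy))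
        omega
      · simp; omega
    · exact ⟨u, hus.trans (List.sublist_append_left _ _), hu, by omega⟩

end BinaryTree

/-! ### Trees encode exactly the 132-avoiding words -/

namespace BinaryTree

lemma avoids132_permWord (t : BinaryTree Unit) (k : ℕ) : (permWord t k).Avoids132 := by
  induction t generalizing k with
  | nil => intro a b c h; simp [permWord] at h
  | node _ l r hl hr =>
    intro a b c h ⟨hac, hcb⟩
    rw [permWord, List.sublist_append_iff] at h
    obtain ⟨u, w, huw, hu, hw⟩ := h
    have hwb : ∀ x ∈ w, x = k + l.numNodes + r.numNodes ∨ x < k + r.numNodes := fun x hx => by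
      have := hw.subset hx
      simp only [List.mem_cons, mem_permWord] at this
      omega
    have hub : ∀ x ∈ u, k + r.numNodes ≤ x ∧ x < k + r.numNodes + l.numNodes := fun x hx =>
      mem_permWord.1 (hu.subset hx)
    match u, huw with
    | [], huw =>
      obtain rfl : [a, b, c] = w := huw
      rcases List.sublist_cons_iff.1 hw with hw | ⟨w', hw', hw''⟩
      · exact hr k a b c hw ⟨hac, hcb⟩
      · simp only [List.cons.injEq] at hw'
        have := hwb b (by simp)
        have := hwb c (by simp)
        omega
    | [x], huw =>
      simp only [List.cons_append, List.cons.injEq, List.nil_append] at huw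
      obtain ⟨rfl, rfl⟩ := huw
      rcases List.sublist_cons_iff.1 hw with hw | ⟨w', hw', hw''⟩
      · have := mem_permWord.1 (hw.subset (by simp : c ∈ [b, c]))
        have := hub a (by simp)
        omega
      · simp only [List.cons.injEq] at hw'
        have := mem_permWord.1 (hw''.subset (by simp [← hw'.2] : c ∈ w'))
        have := hub a (by simp)
        omega
    | [x, y], huw =>
      simp only [List.cons_append, List.cons.injEq, List.nil_append] at huw
      obtain ⟨rfl, rfl, rfl⟩ := huw
      have := hub a (by simp)
      have := hub b (by simp)
      have := hwb c (by simp)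
      omega
    | x :: y :: z :: u, huw =>
      simp only [List.cons_append, List.cons.injEq] at huw
      obtain ⟨rfl, rfl, rfl, huw⟩ := huw
      have : u = [] := by
        have := congrArg List.length huw
        simp at this
        exact List.length_eq_zero_iff.1 (by omega)
      subst this
      exact hl _ a b c hu ⟨hac, hcb⟩

/-- Sorted `B` followed by sorted `A` is a sorted rearrangement of the interval, hence the interval
itself. -/
lemma _root_.List.perm_range'_of_append {A B : List ℕ} {k n : ℕ}
    (h : A ++ B ~ List.range' k n) (hAB : ∀ a ∈ A, ∀ b ∈ B, b ≤ a) :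
    A ~ List.range' (k + B.length) A.length ∧ B ~ List.range' k B.length := by
  have hn : n = B.length + A.length := by
    have := h.length_eq
    simp at this
    omega
  have hA := List.perm_insertionSort (· ≤ ·) A
  have hB := List.perm_insertionSort (· ≤ ·) B
  have hs : (B.insertionSort (· ≤ ·) ++ A.insertionSort (· ≤ ·)).Pairwise (· ≤ ·) := by
    rw [List.pairwise_append]
    exact ⟨List.pairwise_insertionSort _ _, List.pairwise_insertionSort _ _,
      fun b hb a ha => hAB a (hA.mem_iff.1 ha) b (hB.mem_iff.1 hb)⟩
  have hp : B.insertionSort (· ≤ ·) ++ A.insertionSort (· ≤ ·) ~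
      List.range' k B.length ++ List.range' (k + B.length) A.length := by
    rw [List.range'_append_1, ← hn]
    exact ((hB.append hA).trans List.perm_append_comm).trans h
  have hr : (List.range' k B.length ++ List.range' (k + B.length) A.length).Pairwise (· ≤ ·) := by
    rw [List.range'_append_1]
    exact List.pairwise_le_range'
  obtain ⟨h1, h2⟩ := List.append_inj (hp.eq_of_pairwise' hs hr) (by simp)
  exact ⟨h2 ▸ hA.symm, h1 ▸ hB.symm⟩

/-- A smaller letter before the maximum and a larger one after it would form a 132 with it. So the
two sides are intervals of values, and induction applies to each. -/
lemma exists_permWord_eq {n k : ℕ} {w : List ℕ} (h : w ~ List.range' k n) (hw : w.Avoids132) :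
    ∃ t : BinaryTree Unit, t.numNodes = n ∧ permWord t k = w := by
  induction n using Nat.strong_induction_on generalizing k w with
  | _ n ih =>
    rcases n with _ | n
    · exact ⟨nil, rfl, by simpa [permWord, eq_comm] using h⟩
    have hmem : k + n ∈ w := h.mem_iff.2 (by simp [List.mem_range'_1])
    obtain ⟨A, B, rfl⟩ := List.append_of_mem hmem
    have h' : A ++ B ~ List.range' k n := by
      have h1 : (k + n) :: (A ++ B) ~ (k + n) :: List.range' k n := by
        refine (List.perm_middle.symm.trans h).trans ?_
        rw [List.range'_1_concat]
        exact List.perm_append_singleton _ _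
      exact h1.cons_inv
    have hlt : ∀ x ∈ A ++ B, x < k + n := fun x hx => by
      have := h'.mem_iff.1 hx
      simp [List.mem_range'_1] at this
      omega
    have hnd : (A ++ B).Nodup := h'.nodup_iff.2 List.nodup_range'
    have hAB : ∀ a ∈ A, ∀ b ∈ B, b ≤ a := by
      intro a ha b hb
      by_contra! hab
      refine hw a (k + n) b ?_ ⟨hab, hlt b (by simp [hb])⟩
      exact (List.singleton_sublist.2 ha).append ((List.singleton_sublist.2 hb).cons_cons _)
    obtain ⟨hA, hB⟩ := List.perm_range'_of_append h' hAB
    have hlen : A.length + B.length = n := by simpa using h'.length_eq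
    obtain ⟨l, hl, rfl⟩ := ih A.length (by omega) hA
      fun a b c hs => hw a b c (hs.trans (List.sublist_append_left _ _))
    obtain ⟨r, hr, rfl⟩ := ih B.length (by omega) hB
      fun a b c hs => hw a b c
        (hs.trans ((List.sublist_cons_self _ _).trans (List.sublist_append_right _ _)))
    refine ⟨node () l r, by simp [hl, hr]; omega, ?_⟩
    rw [permWord, hr, hl, add_assoc, hlen]

end BinaryTree

/-! ### Permutations as words -/

/-- The one-line notation of a permutation. -/
def Equiv.Perm.word {n : ℕ} (σ : Equiv.Perm (Fin n)) : List ℕ :=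
  List.ofFn fun i => (σ i : ℕ)

namespace Equiv.Perm

variable {n : ℕ}

@[simp] lemma length_word (σ : Equiv.Perm (Fin n)) : σ.word.length = n := by simp [word]

lemma word_injective : Function.Injective (word : Equiv.Perm (Fin n) → List ℕ) := by
  intro σ τ h
  have := List.ofFn_injective h
  ext i
  exact congrFun this i

lemma nodup_word (σ : Equiv.Perm (Fin n)) : σ.word.Nodup :=
  List.nodup_ofFn.2 fun _ _ h => σ.injective (Fin.ext h)

lemma word_perm_range' (σ : Equiv.Perm (Fin n)) : σ.word ~ List.range' 0 n := by
  refine (List.subperm_of_subset σ.nodup_word fun x hx => ?_).perm_of_length_le (by simp)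
  obtain ⟨i, rfl⟩ := List.mem_ofFn.1 hx
  simp [List.mem_range'_1]

lemma exists_word_eq {w : List ℕ} (h : w ~ List.range' 0 n) :
    ∃ σ : Equiv.Perm (Fin n), σ.word = w := by
  have hlen : w.length = n := by simpa using h.length_eq
  subst hlen
  have hlt : ∀ i : Fin w.length, w.get i < w.length := fun i => by
    have := h.mem_iff.1 (w.get_mem i)
    simpa [List.mem_range'_1] using this
  have hinj : Function.Injective fun i : Fin w.length => (⟨w.get i, hlt i⟩ : Fin w.length) := by
    intro i j hij
    exact (List.nodup_iff_injective_get.1 (h.nodup_iff.2 List.nodup_range')) (Fin.ext_iff.1 hij)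
  refine ⟨Equiv.ofBijective _ (Finite.injective_iff_bijective.1 hinj), ?_⟩
  simp only [word, Equiv.ofBijective_apply]
  exact List.ofFn_get w

/-- Sublists of the one-line notation are the subsequences of the permutation. -/
lemma sublist_word_iff {σ : Equiv.Perm (Fin n)} {s : List ℕ} :
    s <+ σ.word ↔ ∃ f : Fin s.length ↪o Fin n, ∀ j, s.get j = σ (f j) := by
  rw [List.sublist_iff_exists_fin_orderEmbedding_get_eq]
  constructor
  · rintro ⟨f, hf⟩
    exact ⟨f.trans (Fin.castOrderIso σ.length_word).toOrderEmbedding, fun j => by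
      rw [hf j, List.get_eq_getElem]
      simp only [word, List.getElem_ofFn]
      rfl⟩
  · rintro ⟨f, hf⟩
    exact ⟨f.trans (Fin.castOrderIso σ.length_word.symm).toOrderEmbedding, fun j => by
      rw [hf j, List.get_eq_getElem]
      simp only [word, List.getElem_ofFn]
      rfl⟩

lemma avoidsPattern_iff (σ : Equiv.Perm (Fin n)) :
    AvoidsPattern σ pattern132 ↔ σ.word.Avoids132 := by
  rw [AvoidsPattern, List.Avoids132, ← not_iff_not]
  push Not
  constructor
  · rintro ⟨i, hi⟩
    refine ⟨σ (i 0), σ (i 1), σ (i 2), sublist_word_iff.2 ⟨i, ?_⟩, (hi 0 2).2 (by decide),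
      (hi 2 1).2 (by decide)⟩
    intro j
    fin_cases j <;> rfl
  · rintro ⟨a, b, c, hs, hac, hcb⟩
    obtain ⟨f, hf⟩ := sublist_word_iff.1 hs
    refine ⟨f, ?_⟩
    have h0 : a = σ (f 0) := hf 0
    have h1 : b = σ (f 1) := hf 1
    have h2 : c = σ (f 2) := hf 2
    intro j k
    simp only [Fin.lt_def]
    fin_cases j <;> fin_cases k <;> simp [pattern132, Equiv.swap_apply_def] <;> omega

lemma followsUUD_ofFn {m : ℕ} (s : Fin (m + 1) → ℕ) :
    (List.ofFn s).FollowsUUD 0 ↔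
      ∀ j : Fin m, (patternUUD (Fin.ofNat 3 j)).Step (s j.castSucc) (s j.succ) := by
  rw [List.followsUUD_iff_getElem]
  have key : ∀ (j : ℕ) (a b : ℕ), (if (0 + j) % 3 = 2 then b < a else a < b) ↔
      (patternUUD (Fin.ofNat 3 j)).Step a b := by
    intro j a b
    rw [zero_add, show j % 3 = (Fin.ofNat 3 j : ℕ) from rfl]
    generalize Fin.ofNat 3 j = q
    fin_cases q <;> simp [patternUUD, UpDown.Step]
  simp only [key, List.length_ofFn, List.getElem_ofFn]
  exact ⟨fun h j => h j (by omega), fun h j hj => h ⟨j, by omega⟩⟩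

lemma step_val_iff {v : UpDown} {a b : Fin n} : v.Step (a : ℕ) (b : ℕ) ↔ v.Step a b := by
  cases v <;> rfl

lemma exists_repeatsPattern_iff {σ : Equiv.Perm (Fin n)} {k : ℕ} :
    (∃ i : Fin (k * 3 + 1) ↪o Fin n, RepeatsPattern patternUUD σ k i) ↔
      ∃ s, s <+ σ.word ∧ s.FollowsUUD 0 ∧ s.length = k * 3 + 1 := by
  constructor
  · rintro ⟨i, hi⟩
    refine ⟨List.ofFn fun j => (σ (i j) : ℕ), ?_, ?_, by simp⟩
    · rw [sublist_word_iff]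
      exact ⟨(Fin.castOrderIso (by simp)).toOrderEmbedding.trans i, fun j => by
        simp only [List.get_eq_getElem, List.getElem_ofFn]
        rfl⟩
    · rw [followsUUD_ofFn]
      exact fun j => step_val_iff.2 (hi j)
  · rintro ⟨s, hs, h, hl⟩
    obtain ⟨f, hf⟩ := sublist_word_iff.1 hs
    have hs' : s = List.ofFn fun j : Fin (k * 3 + 1) => (σ (f (j.cast hl.symm)) : ℕ) := by
      apply List.ext_get (by simp [hl])
      intro j h1 h2
      rw [hf ⟨j, h1⟩]
      simp only [List.get_eq_getElem, List.getElem_ofFn]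
      rfl
    rw [hs', followsUUD_ofFn] at h
    exact ⟨(Fin.castOrderIso hl.symm).toOrderEmbedding.trans f, fun j => step_val_iff.1 (h j)⟩

lemma exists_repeatsPattern_iff_le_maxPrefix {σ : Equiv.Perm (Fin n)} {t : BinaryTree Unit}
    (ht : t.permWord 0 = σ.word) {k : ℕ} :
    (∃ i : Fin (k * 3 + 1) ↪o Fin n, RepeatsPattern patternUUD σ k i) ↔
      k * 3 + 1 ≤ t.maxPrefix := by
  rw [exists_repeatsPattern_iff, ← ht]
  constructor
  · rintro ⟨s, hs, h, hl⟩
    exact hl ▸ BinaryTree.length_le_maxPrefix hs h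
  · intro hk
    obtain ⟨s, hs, h, hl⟩ := t.exists_sublist_length_eq_maxPrefix 0
    exact ⟨s.take (k * 3 + 1), (List.take_sublist _ _).trans hs, h.take _, by simp; omega⟩

lemma longestRepeat_mem {l : ℕ} [NeZero l] (V : Fin l → UpDown) (σ : Equiv.Perm (Fin n)) :
    longestRepeat V σ = 0 ∨ ∃ k : ℕ, 1 ≤ k ∧ longestRepeat V σ = k * l + 1 ∧
      ∃ i : Fin (k * l + 1) ↪o Fin n, RepeatsPattern V σ k i := by
  rw [longestRepeat]
  set S := {m : ℕ | ∃ k : ℕ, 1 ≤ k ∧ m = k * l + 1 ∧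
    ∃ i : Fin (k * l + 1) ↪o Fin n, RepeatsPattern V σ k i}
  rcases S.eq_empty_or_nonempty with h | h
  · simp [h]
  · refine Or.inr (Nat.sSup_mem h ⟨n, ?_⟩)
    rintro m ⟨k, -, rfl, i, -⟩
    simpa using Fintype.card_le_of_injective i i.injective

lemma le_longestRepeat {l : ℕ} [NeZero l] {V : Fin l → UpDown} {σ : Equiv.Perm (Fin n)} {k : ℕ}
    (hk : 1 ≤ k) (h : ∃ i : Fin (k * l + 1) ↪o Fin n, RepeatsPattern V σ k i) :
    k * l + 1 ≤ longestRepeat V σ := by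
  refine le_csSup ⟨n, ?_⟩ ⟨k, hk, rfl, h⟩
  rintro m ⟨k, -, rfl, i, -⟩
  simpa using Fintype.card_le_of_injective i i.injective

/-- `k` copies of `UUD` take `3k + 1` letters, so the last triple may lack its closing descent; the
slack 3 covers this and the default value 0. -/
lemma longestRepeat_bounds {σ : Equiv.Perm (Fin n)} {t : BinaryTree Unit}
    (ht : t.permWord 0 = σ.word) :
    longestRepeat patternUUD σ ≤ 3 * (t.maxPrefix / 3) + 3 ∧
      3 * (t.maxPrefix / 3) ≤ longestRepeat patternUUD σ + 3 := by
  constructor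
  · rcases longestRepeat_mem patternUUD σ with h | ⟨k, -, h, hi⟩
    · omega
    · rw [exists_repeatsPattern_iff_le_maxPrefix ht] at hi
      omega
  · by_cases hk : 1 ≤ t.maxPrefix / 3 - 1
    · have := le_longestRepeat hk ((exists_repeatsPattern_iff_le_maxPrefix ht).2 (by omega))
      omega
    · omega

end Equiv.Perm

/-! ### Transfer of the expectation to trees -/

lemma catalan_pos (n : ℕ) : 0 < catalan n := by
  have h := succ_mul_catalan_eq_centralBinom n
  have := n.centralBinom_pos
  exact Nat.pos_of_ne_zero fun h0 => by simp [h0] at h; omega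

open BinaryTree in
lemma exists_equiv_avoiders (n : ℕ) :
    ∃ e : {t // t ∈ treesOfNumNodesEq n} ≃ {σ // σ ∈ avoiders n pattern132},
      ∀ t, t.1.permWord 0 = (e t).1.word := by
  have hex : ∀ t : {t // t ∈ treesOfNumNodesEq n}, ∃ σ : {σ // σ ∈ avoiders n pattern132},
      t.1.permWord 0 = σ.1.word := by
    rintro ⟨t, ht⟩
    rw [mem_treesOfNumNodesEq] at ht
    have hp : t.permWord 0 ~ List.range' 0 n := by
      refine (List.subperm_of_subset (t.nodup_permWord 0) fun x hx => ?_).perm_of_length_le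
        (by simp [length_permWord, ht])
      rw [mem_permWord, ht] at hx
      simpa [List.mem_range'_1] using hx
    obtain ⟨σ, hσ⟩ := Equiv.Perm.exists_word_eq hp
    refine ⟨⟨σ, ?_⟩, hσ.symm⟩
    simp only [avoiders, Finset.mem_filter, Finset.mem_univ, true_and]
    rw [Equiv.Perm.avoidsPattern_iff, hσ]
    exact t.avoids132_permWord 0
  choose e he using hex
  refine ⟨Equiv.ofBijective e ⟨fun t t' h => ?_, fun σ => ?_⟩, he⟩
  · exact Subtype.ext (permWord_injective (k := 0) (by rw [he, he, h]))
  · obtain ⟨σ, hσ⟩ := σ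
    simp only [avoiders, Finset.mem_filter, Finset.mem_univ, true_and] at hσ
    rw [Equiv.Perm.avoidsPattern_iff] at hσ
    obtain ⟨t, ht, htw⟩ := exists_permWord_eq σ.word_perm_range' hσ
    refine ⟨⟨t, mem_treesOfNumNodesEq.2 ht⟩, Subtype.ext (Equiv.Perm.word_injective ?_)⟩
    rw [← he, htw]

open BinaryTree in
lemma abs_avoidersExpectation_sub_le (n : ℕ) :
    |avoidersExpectation pattern132
        (fun σ : Equiv.Perm (Fin n) => (longestRepeat patternUUD σ : ℝ)) -
      3 * ((∑ t ∈ treesOfNumNodesEq n, ((t.maxPrefix / 3 : ℕ) : ℝ)) / catalan n)| ≤ 3 := by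
  obtain ⟨e, he⟩ := exists_equiv_avoiders n
  have hcard : (avoiders n pattern132).card = catalan n := by
    rw [← treesOfNumNodesEq_card_eq_catalan]
    exact (Finset.card_eq_of_equiv e).symm
  have hpos : (0 : ℝ) < catalan n := Nat.cast_pos.2 (catalan_pos n)
  rw [avoidersExpectation, hcard, ← mul_div_assoc, ← sub_div, abs_div, abs_of_pos hpos,
    div_le_iff₀ hpos, ← Finset.sum_coe_sort (avoiders n pattern132), ← e.sum_comp,
    ← Finset.sum_coe_sort (treesOfNumNodesEq n), Finset.mul_sum, ← Finset.sum_sub_distrib]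
  refine (Finset.abs_sum_le_sum_abs _ _).trans ?_
  calc _ ≤ ∑ t : {t // t ∈ treesOfNumNodesEq n}, (3 : ℝ) := by
        refine Finset.sum_le_sum fun t _ => ?_
        obtain ⟨h1, h2⟩ := Equiv.Perm.longestRepeat_bounds (he t)
        rw [abs_le]
        constructor
        · rw [neg_le_sub_iff_le_add]
          exact_mod_cast h2
        · rw [sub_le_iff_le_add']
          exact_mod_cast h1
    _ = 3 * catalan n := by
        rw [← treesOfNumNodesEq_card_eq_catalan]
        simp [mul_comm]

/-! ### Generating functions of trees and their values at 1/4 -/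

namespace BinaryTree

open Finset PowerSeries

/-- The total of `h` over the binary trees with `n` nodes. -/
noncomputable def treeSum (h : BinaryTree Unit → ℝ) (n : ℕ) : ℝ :=
  ∑ t ∈ treesOfNumNodesEq n, h t

lemma treeSum_zero (h : BinaryTree Unit → ℝ) : treeSum h 0 = h nil := by
  simp [treeSum]

lemma treeSum_one (n : ℕ) : treeSum (fun _ => 1) n = catalan n := by
  simp [treeSum, treesOfNumNodesEq_card_eq_catalan]

lemma treeSum_succ {ι : Type*} {s : Finset ι} {h : BinaryTree Unit → ℝ}
    {f g : ι → BinaryTree Unit → ℝ} (hh : ∀ l r, h (node () l r) = ∑ k ∈ s, f k l * g k r) (n : ℕ) :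
    treeSum h (n + 1) =
      ∑ k ∈ s, ∑ ij ∈ antidiagonal n, treeSum (f k) ij.1 * treeSum (g k) ij.2 := by
  rw [treeSum, treesOfNumNodesEq_succ, sum_biUnion, sum_comm]
  · refine sum_congr rfl fun ij _ => ?_
    rw [pairwiseNode, sum_map, sum_product]
    simp only [treeSum, sum_mul_sum]
    rw [sum_comm (s := s)]
    refine sum_congr rfl fun l _ => ?_
    rw [sum_comm (s := s)]
    exact sum_congr rfl fun r _ => hh l r
  · simp_rw [Set.PairwiseDisjoint, Set.Pairwise, disjoint_left]
    aesop

/-- The ordinary generating function of `treeSum h`. -/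
noncomputable def treeSeries (h : BinaryTree Unit → ℝ) : ℝ⟦X⟧ := PowerSeries.mk (treeSum h)

lemma treeSeries_eq {ι : Type*} {s : Finset ι} {h : BinaryTree Unit → ℝ}
    {f g : ι → BinaryTree Unit → ℝ} (hh : ∀ l r, h (node () l r) = ∑ k ∈ s, f k l * g k r) :
    treeSeries h = C (h nil) + X * ∑ k ∈ s, treeSeries (f k) * treeSeries (g k) := by
  ext n
  cases n with
  | zero => simp [treeSeries, treeSum_zero]
  | succ n =>
    rw [map_add, coeff_succ_X_mul]
    simp [treeSeries, treeSum_succ hh, coeff_mul]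

/-- The value at `1 / 4` of the generating function of `treeSum h`. -/
noncomputable def criticalSum (h : BinaryTree Unit → ℝ) : ℝ := ∑' n, treeSum h n / 4 ^ n

lemma abs_treeSum_le {h : BinaryTree Unit → ℝ} (hh : ∀ t, |h t| ≤ 1) (n : ℕ) :
    |treeSum h n| ≤ catalan n := by
  rw [← treeSum_one]
  exact (abs_sum_le_sum_abs _ _).trans (sum_le_sum fun t _ => hh t)

/-- The closed form bounds the partial sums by 2, giving convergence at the radius of convergence
itself. -/
lemma sum_catalan_div_four_pow (n : ℕ) :
    ∑ i ∈ range n, (catalan i : ℝ) / 4 ^ i = 2 - 2 * n.centralBinom / 4 ^ n := by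
  induction n with
  | zero => simp
  | succ n ih =>
    have h1 : ((n : ℝ) + 1) * catalan n = n.centralBinom := by
      exact_mod_cast succ_mul_catalan_eq_centralBinom n
    have h2 : ((n : ℝ) + 1) * (n + 1).centralBinom = 2 * (2 * n + 1) * n.centralBinom := by
      exact_mod_cast n.succ_mul_centralBinom_succ
    have hn : (n : ℝ) + 1 ≠ 0 := by positivity
    have h3 : ((n + 1).centralBinom : ℝ) = 2 * (2 * n + 1) * catalan n := by
      apply mul_left_cancel₀ hn
      rw [h2, ← h1]
      ring
    rw [sum_range_succ, ih, h3, ← h1, pow_succ]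
    field_simp
    ring

lemma summable_catalan_div_four_pow : Summable fun n => (catalan n : ℝ) / 4 ^ n :=
  summable_of_sum_range_le (c := 2) (fun n => by positivity) fun n => by
    rw [sum_catalan_div_four_pow]
    have : 0 ≤ 2 * (n.centralBinom : ℝ) / 4 ^ n := by positivity
    linarith

lemma summable_abs_treeSum {h : BinaryTree Unit → ℝ} (hh : ∀ t, |h t| ≤ 1) :
    Summable fun n => ‖treeSum h n / 4 ^ n‖ :=
  summable_catalan_div_four_pow.of_nonneg_of_le (fun _ => norm_nonneg _) fun n => by
    rw [norm_div, Real.norm_eq_abs, norm_pow, Real.norm_ofNat]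
    gcongr
    exact abs_treeSum_le hh n

lemma criticalSum_add {f g : BinaryTree Unit → ℝ} (hf : ∀ t, |f t| ≤ 1) (hg : ∀ t, |g t| ≤ 1) :
    criticalSum (fun t => f t + g t) = criticalSum f + criticalSum g := by
  rw [criticalSum, criticalSum, criticalSum,
    ← (summable_abs_treeSum hf).of_norm.tsum_add (summable_abs_treeSum hg).of_norm]
  simp only [treeSum, sum_add_distrib, add_div]

lemma criticalSum_sub {f g : BinaryTree Unit → ℝ} (hf : ∀ t, |f t| ≤ 1) (hg : ∀ t, |g t| ≤ 1) :
    criticalSum (fun t => f t - g t) = criticalSum f - criticalSum g := by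
  rw [criticalSum, criticalSum, criticalSum,
    ← (summable_abs_treeSum hf).of_norm.tsum_sub (summable_abs_treeSum hg).of_norm]
  simp only [treeSum, sum_sub_distrib, sub_div]

/-- Decomposition at the root and Cauchy products; the root node contributes the factor 1/4. -/
lemma criticalSum_eq {ι : Type*} {s : Finset ι} {h : BinaryTree Unit → ℝ}
    {f g : ι → BinaryTree Unit → ℝ} (hh : ∀ l r, h (node () l r) = ∑ k ∈ s, f k l * g k r)
    (h1 : ∀ t, |h t| ≤ 1) (hf : ∀ k t, |f k t| ≤ 1) (hg : ∀ k t, |g k t| ≤ 1) :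
    criticalSum h = h nil + (∑ k ∈ s, criticalSum (f k) * criticalSum (g k)) / 4 := by
  rw [criticalSum, (summable_abs_treeSum h1).of_norm.tsum_eq_zero_add, treeSum_zero, pow_zero,
    div_one]
  congr 1
  have key : ∀ k n, (∑ ij ∈ antidiagonal n, treeSum (f k) ij.1 / 4 ^ ij.1 *
      (treeSum (g k) ij.2 / 4 ^ ij.2)) =
      (∑ ij ∈ antidiagonal n, treeSum (f k) ij.1 * treeSum (g k) ij.2) / 4 ^ n := by
    intro k n
    rw [sum_div]
    refine sum_congr rfl fun ij hij => ?_
    rw [← mem_antidiagonal.1 hij, pow_add, div_mul_div_comm]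
  simp only [criticalSum]
  simp_rw [tsum_mul_tsum_eq_tsum_sum_antidiagonal_of_summable_norm (summable_abs_treeSum (hf _))
    (summable_abs_treeSum (hg _)), key]
  rw [← Summable.tsum_finsetSum, ← tsum_div_const]
  · simp_rw [treeSum_succ hh, pow_succ, ← sum_div, div_div]
  · intro k _
    simp_rw [← key]
    exact (summable_norm_sum_mul_antidiagonal_of_summable_norm (summable_abs_treeSum (hf k))
      (summable_abs_treeSum (hg k))).of_norm

lemma criticalSum_one : criticalSum (fun _ => 1) = 2 := by
  have := criticalSum_eq (s := ({()} : Finset Unit)) (h := fun _ => 1) (f := fun _ _ => 1)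
    (g := fun _ _ => 1) (by simp) (by simp) (by simp) (by simp)
  rw [sum_singleton] at this
  -- The equation `T = 1 + T² / 4` has the double root 2.
  nlinarith [sq_nonneg (criticalSum (fun _ => 1) - 2)]

/-! ### Critical sums of the residue classes of `maxPrefix` -/

/-- The indicator function of a set of trees. -/
noncomputable def ind (P : BinaryTree Unit → Prop) [DecidablePred P] (t : BinaryTree Unit) : ℝ :=
  if P t then 1 else 0

lemma abs_ind_le (P : BinaryTree Unit → Prop) [DecidablePred P] (t : BinaryTree Unit) :
    |ind P t| ≤ 1 := by
  rw [ind]; split_ifs <;> simp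

lemma criticalSum_ind_or {P Q : BinaryTree Unit → Prop} [DecidablePred P] [DecidablePred Q]
    (h : ∀ t, P t → ¬ Q t) :
    criticalSum (ind fun t => P t ∨ Q t) = criticalSum (ind P) + criticalSum (ind Q) := by
  rw [← criticalSum_add (abs_ind_le P) (abs_ind_le Q)]
  congr 1
  ext t
  have := h t
  by_cases hP : P t <;> by_cases hQ : Q t <;> simp_all [ind]

lemma criticalSum_ind_not (P : BinaryTree Unit → Prop) [DecidablePred P] :
    criticalSum (ind fun t => ¬ P t) = 2 - criticalSum (ind P) := by
  rw [← criticalSum_one, ← criticalSum_sub (by simp) (abs_ind_le P)]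
  congr 1
  ext t
  by_cases hP : P t <;> simp [ind, hP]

lemma maxPrefix_node (l r : BinaryTree Unit) : maxPrefix (node () l r) =
    max (if maxPrefix l % 3 = 0 ∧ maxPrefix l ≠ 0 then maxPrefix l else maxPrefix l + 1)
      ((if maxPrefix l % 3 = 0 ∧ maxPrefix l ≠ 0 then maxPrefix l else maxPrefix l + 1) / 3 * 3 +
        maxPrefix r) := rfl

lemma criticalSum_node {P A B A' B' : BinaryTree Unit → Prop} [DecidablePred P] [DecidablePred A]
    [DecidablePred B] [DecidablePred A'] [DecidablePred B'] (h0 : ¬ P nil)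
    (h : ∀ l r, P (node () l r) ↔ A l ∧ B r ∨ A' l ∧ B' r)
    (hd : ∀ l r, A l → B r → A' l → B' r → False) :
    criticalSum (ind P) = (criticalSum (ind A) * criticalSum (ind B) +
      criticalSum (ind A') * criticalSum (ind B')) / 4 := by
  have := criticalSum_eq (s := (univ : Finset Bool)) (h := ind P)
    (f := fun k => if k then ind A else ind A') (g := fun k => if k then ind B else ind B')
    (fun l r => ?_) (abs_ind_le P) (fun k => ?_) (fun k => ?_)
  · simpa [ind, h0] using this
  · have := hd l r
    simp only [Fintype.sum_bool, if_true, Bool.false_eq_true, if_false]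
    simp only [ind, h]
    by_cases hA : A l <;> by_cases hB : B r <;> by_cases hA' : A' l <;> by_cases hB' : B' r <;>
      simp_all
  · cases k
    · exact abs_ind_le A'
    · exact abs_ind_le A
  · cases k
    · exact abs_ind_le B'
    · exact abs_ind_le B

lemma criticalSum_ind_false : criticalSum (ind fun _ => False) = 0 := by
  simp [criticalSum, treeSum, ind]

lemma maxPrefix_eq_zero_iff {t : BinaryTree Unit} : maxPrefix t = 0 ↔ t = nil := by
  cases t with
  | nil => simp [maxPrefix]
  | node _ l r =>
    refine iff_of_false ?_ (by simp)
    rw [maxPrefix_node]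
    split_ifs <;> omega

lemma criticalSum_maxPrefix_eq_zero : criticalSum (ind fun t => maxPrefix t = 0) = 1 := by
  have := criticalSum_eq (s := (∅ : Finset Unit)) (h := ind fun t => maxPrefix t = 0)
    (f := fun _ _ => 0) (g := fun _ _ => 0) (fun l r => ?_) (abs_ind_le _) (by simp) (by simp)
  · simpa [ind, maxPrefix] using this
  · simp [ind, maxPrefix_eq_zero_iff]

/-- The left subtree must be empty and the right one have value 0 or 1, whence `x = (1 + x) / 4`. -/
lemma criticalSum_maxPrefix_eq_one : criticalSum (ind fun t => maxPrefix t = 1) = 1 / 3 := by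
  have := criticalSum_node (P := fun t => maxPrefix t = 1) (A := fun t => maxPrefix t = 0)
    (B := fun t => maxPrefix t = 0 ∨ maxPrefix t = 1) (A' := fun _ => False) (B' := fun _ => False)
    (by simp [maxPrefix]) (fun l r => by
      simp only [maxPrefix_node, max_def, false_and, or_false]
      split_ifs <;> omega) (by simp)
  rw [criticalSum_ind_or (fun t => by omega), criticalSum_ind_false,
    criticalSum_maxPrefix_eq_zero] at this
  linarith

/-- A right value of at least 2 fixes the residue. With right value 1, the residue is 1 unless the
left residue is 1, and the total exceeds 1 unless the left is empty. The value 1 is split off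
because it alone behaves differently on the right. -/
lemma criticalSum_maxPrefix_mod_three_eq_one :
    criticalSum (ind fun t => maxPrefix t % 3 = 1) = 3 / 7 := by
  have h := criticalSum_node (P := fun t => maxPrefix t % 3 = 1 ∧ maxPrefix t ≠ 1)
    (A := fun _ => True)
    (B := fun t => maxPrefix t % 3 = 1 ∧ maxPrefix t ≠ 1)
    (A' := fun t => ¬ (maxPrefix t = 0 ∨ maxPrefix t % 3 = 1)) (B' := fun t => maxPrefix t = 1)
    (by simp [maxPrefix]) (fun l r => by
      simp only [maxPrefix_node, max_def, true_and]
      split_ifs <;> omega)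
    (fun l r => by omega)
  have h1 : criticalSum (ind fun t => maxPrefix t % 3 = 1) =
      criticalSum (ind fun t => maxPrefix t % 3 = 1 ∧ maxPrefix t ≠ 1) + 1 / 3 := by
    rw [← criticalSum_maxPrefix_eq_one, ← criticalSum_ind_or (fun t => by omega)]
    congr 2
    ext t
    omega
  have ht : criticalSum (ind fun _ => True) = 2 := by
    rw [← criticalSum_one]
    congr 1
  rw [criticalSum_ind_not, criticalSum_ind_or (fun t => by omega), ht,
    criticalSum_maxPrefix_eq_zero, criticalSum_maxPrefix_eq_one] at h
  linarith

/-- Residue 2 comes from the right subtree, or, when the right value is at most 1, from the root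
letter appended to a left residue 1. -/
lemma criticalSum_maxPrefix_mod_three_eq_two :
    criticalSum (ind fun t => maxPrefix t % 3 = 2) = 2 / 7 := by
  have h := criticalSum_node (P := fun t => maxPrefix t % 3 = 2)
    (A := fun _ => True)
    (B := fun t => maxPrefix t % 3 = 2)
    (A' := fun t => maxPrefix t % 3 = 1) (B' := fun t => maxPrefix t = 0 ∨ maxPrefix t = 1)
    (by simp [maxPrefix]) (fun l r => by
      simp only [maxPrefix_node, max_def, true_and]
      split_ifs <;> omega)
    (fun l r => by omega)
  have ht : criticalSum (ind fun _ => True) = 2 := by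
    rw [← criticalSum_one]
    congr 1
  rw [criticalSum_ind_or (fun t => by omega), ht, criticalSum_maxPrefix_mod_three_eq_one,
    criticalSum_maxPrefix_eq_zero, criticalSum_maxPrefix_eq_one] at h
  linarith

end BinaryTree

/-! ### Limits of weights and of central binomial ratios -/

open Topology in
/-- A discrete form of Scheffé's lemma: if probability weights converge pointwise to probability
weights, then the expectations of a bounded function converge. -/
lemma tendsto_tsum_mul_of_hasSum_one {ι : Type*} {p : ℕ → ι → ℝ} {a r : ι → ℝ}
    (hp : ∀ n i, 0 ≤ p n i) (hlim : ∀ i, Tendsto (fun n => p n i) atTop (𝓝 (a i)))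
    (ha : HasSum a 1) (hp1 : ∀ᶠ n in atTop, HasSum (p n) 1) (hr0 : ∀ i, 0 ≤ r i)
    (hr1 : ∀ i, r i ≤ 1) :
    Tendsto (fun n => ∑' i, p n i * r i) atTop (𝓝 (∑' i, a i * r i)) := by
  have ha0 : ∀ i, 0 ≤ a i := fun i => ge_of_tendsto' (hlim i) fun n => hp n i
  -- The `p n` need have no common summable bound, but `min (p n i) (a i)` is dominated by `a`.
  have key : ∀ q : ι → ℝ, (∀ i, 0 ≤ q i) → (∀ i, q i ≤ 1) →
      Tendsto (fun n => ∑' i, min (p n i) (a i) * q i) atTop (𝓝 (∑' i, a i * q i)) := by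
    intro q hq0 hq1
    refine tendsto_tsum_of_dominated_convergence (bound := a) ha.summable (fun i => ?_)
      (Eventually.of_forall fun n i => ?_)
    · have := ((hlim i).min (tendsto_const_nhds (x := a i))).mul_const (q i)
      simpa using this
    · have h0 : 0 ≤ min (p n i) (a i) := le_min (hp n i) (ha0 i)
      rw [Real.norm_of_nonneg (mul_nonneg h0 (hq0 i))]
      exact (mul_le_of_le_one_right h0 (hq1 i)).trans (min_le_right _ _)
  have h1 := key (fun _ => 1) (fun _ => zero_le_one) (fun _ => le_rfl)
  simp only [mul_one, ha.tsum_eq] at h1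
  have hr := key r hr0 hr1
  have hsm : ∀ n, Summable fun i => min (p n i) (a i) := fun n =>
    ha.summable.of_nonneg_of_le (fun i => le_min (hp n i) (ha0 i)) fun i => min_le_right _ _
  have hmul : ∀ f : ι → ℝ, (∀ i, 0 ≤ f i) → Summable f → Summable fun i => f i * r i :=
    fun f hf hs => hs.of_nonneg_of_le (fun i => mul_nonneg (hf i) (hr0 i))
      fun i => mul_le_of_le_one_right (hf i) (hr1 i)
  -- Above, the excess of `p n` over the minimum has total mass `1 - ∑ min`, which tends to 0.
  refine tendsto_of_tendsto_of_tendsto_of_le_of_le' hr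
    (by simpa using hr.add (h1.const_sub 1)) ?_ ?_
  · filter_upwards [hp1] with n hn
    exact (hmul _ (fun i => le_min (hp n i) (ha0 i)) (hsm n)).tsum_le_tsum
      (fun i => mul_le_mul_of_nonneg_right (min_le_left _ _) (hr0 i)) (hmul _ (hp n) hn.summable)
  · filter_upwards [hp1] with n hn
    rw [← hn.tsum_eq, ← hn.summable.tsum_sub (hsm n),
      ← (hmul _ (fun i => le_min (hp n i) (ha0 i)) (hsm n)).tsum_add (hn.summable.sub (hsm n))]
    refine (hmul _ (hp n) hn.summable).tsum_le_tsum (fun i => ?_)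
      ((hmul _ (fun i => le_min (hp n i) (ha0 i)) (hsm n)).add (hn.summable.sub (hsm n)))
    nlinarith [min_le_left (p n i) (a i), hr0 i, hr1 i]

open Topology in
lemma tendsto_centralBinom_sub_div (i : ℕ) :
    Tendsto (fun n : ℕ => ((n - i).centralBinom : ℝ) / n.centralBinom) atTop
      (𝓝 (1 / 4 ^ i)) := by
  have hratio : Tendsto (fun n : ℕ => (n.centralBinom : ℝ) / (n + 1).centralBinom) atTop
      (𝓝 (1 / 4)) := by
    -- This is the exact ratio `(n + 1) / (2 * (2 * n + 1))`.
    have h1 : Tendsto (fun n : ℕ => 1 / 4 + 1 / 8 * (1 / ((n : ℝ) + 1 / 2))) atTop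
        (𝓝 (1 / 4 + 1 / 8 * 0)) := by
      refine tendsto_const_nhds.add (Tendsto.const_mul _ ?_)
      simp_rw [one_div]
      exact tendsto_inv_atTop_zero.comp
        (tendsto_atTop_add_const_right _ _ tendsto_natCast_atTop_atTop)
    rw [mul_zero, add_zero] at h1
    refine h1.congr fun n => ?_
    have h2 : ((n : ℝ) + 1) * (n + 1).centralBinom = 2 * (2 * n + 1) * n.centralBinom := by
      exact_mod_cast n.succ_mul_centralBinom_succ
    have h3 : (0 : ℝ) < (n + 1).centralBinom := by exact_mod_cast (n + 1).centralBinom_pos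
    rw [eq_div_iff h3.ne']
    field_simp
    linarith
  induction i with
  | zero =>
    refine tendsto_const_nhds.congr fun n => ?_
    have : (0 : ℝ) < n.centralBinom := by exact_mod_cast n.centralBinom_pos
    simp [this.ne']
  | succ i ih =>
    rw [← tendsto_add_atTop_iff_nat 1]
    have := ih.mul hratio
    rw [show (1 : ℝ) / 4 ^ i * (1 / 4) = 1 / 4 ^ (i + 1) by rw [pow_succ]; field_simp] at this
    refine this.congr fun n => ?_
    have : (0 : ℝ) < n.centralBinom := by exact_mod_cast n.centralBinom_pos
    rw [Nat.add_sub_add_right]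
    field_simp

/-! ### Additive functionals -/

namespace BinaryTree

open Finset PowerSeries

lemma treeSeries_one_eq :
    treeSeries (fun _ => 1) = 1 + X * (treeSeries (fun _ => 1) * treeSeries (fun _ => 1)) := by
  have := treeSeries_eq (s := ({()} : Finset Unit)) (h := fun _ => 1) (f := fun _ _ => 1)
    (g := fun _ _ => 1) (by simp)
  simpa using this

/-- With `P = X * T`, the derivative of `P` is the central binomial series `B`. Differentiating `P =
X + P²` gives `B = 1 + 2 * P * B`. -/
lemma mk_centralBinom_mul :
    (PowerSeries.mk fun n => (n.centralBinom : ℝ)) * (1 - 2 * X * treeSeries (fun _ => 1)) = 1 := by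
  have hd : d⁄dX ℝ (X * treeSeries (fun _ => 1)) =
      PowerSeries.mk fun n => (n.centralBinom : ℝ) := by
    ext n
    rw [coeff_derivative, coeff_succ_X_mul, treeSeries, coeff_mk, coeff_mk, treeSum_one, mul_comm]
    exact_mod_cast succ_mul_catalan_eq_centralBinom n
  have h : X * treeSeries (fun _ => 1) =
      X + (X * treeSeries (fun _ => 1)) * (X * treeSeries (fun _ => 1)) := by
    conv_lhs => rw [treeSeries_one_eq]
    ring
  rw [mul_assoc]
  generalize X * treeSeries (fun _ => 1) = P at h hd ⊢
  have h' := congrArg (d⁄dX ℝ) h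
  rw [map_add, derivative_X, Derivation.leibniz, hd, smul_eq_mul] at h'
  linear_combination h'

/-- An additive functional of binary trees is determined by its toll function: if
`h (node l r) = h l + h r + c l`, then the totals of `h` are a convolution of the totals of `c` with
half the central binomial coefficients. -/
lemma two_mul_treeSum_of_additive {h c : BinaryTree Unit → ℝ} (h0 : h nil = 0)
    (hh : ∀ l r, h (node () l r) = h l + h r + c l) (n : ℕ) :
    2 * treeSum h n = ∑ i ∈ range (n + 1),
      treeSum c i * if n - i = 0 then 0 else ((n - i).centralBinom : ℝ) := by
  have h1 := treeSeries_eq (s := (univ : Finset (Fin 3))) (h := h) (f := ![h, fun _ => 1, c])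
    (g := ![fun _ => 1, h, fun _ => 1]) (fun l r => by simp [Fin.sum_univ_three, hh])
  simp only [Fin.sum_univ_three, h0, map_zero, zero_add, Matrix.cons_val] at h1
  -- Here `H * (1 - 2XT) = X * T * C`; multiply by `2B` and use `2XTB = B - 1`.
  have h2 : 2 * treeSeries h = treeSeries c *
      ((PowerSeries.mk fun n => (n.centralBinom : ℝ)) - 1) := by
    have hB := mk_centralBinom_mul
    set B : ℝ⟦X⟧ := PowerSeries.mk fun n => (n.centralBinom : ℝ)
    set T := treeSeries fun _ => 1
    linear_combination (-2 * treeSeries h - treeSeries c) * hB + 2 * B * h1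
  have h3 := congrArg (coeff n) h2
  rw [two_mul, map_add, ← two_mul, coeff_mul, Nat.sum_antidiagonal_eq_sum_range_succ_mk] at h3
  simp only [treeSeries, coeff_mk, map_sub, coeff_one] at h3
  rw [h3]
  refine sum_congr rfl fun i _ => ?_
  congr 1
  split_ifs with hi <;> simp [hi]

/-- The number of nodes is additive with toll 1; this normalises the convolution weights to
probabilities. -/
lemma two_mul_mul_catalan (n : ℕ) :
    2 * (n * (catalan n : ℝ)) = ∑ i ∈ range (n + 1),
      (catalan i : ℝ) * if n - i = 0 then 0 else ((n - i).centralBinom : ℝ) := by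
  have h := two_mul_treeSum_of_additive (h := fun t => (t.numNodes : ℝ)) (c := fun _ => 1)
    (by simp) (by simp) n
  simp only [treeSum_one] at h
  rw [← h, treeSum, sum_congr rfl fun t ht => by rw [mem_treesOfNumNodesEq.1 ht]]
  simp [treesOfNumNodesEq_card_eq_catalan, mul_comm]

open Topology in
/-- The mean of an additive functional with a toll function bounded by `1` is asymptotically linear,
and its slope is half the critical sum of the toll function. -/
lemma tendsto_mean_of_additive {h c : BinaryTree Unit → ℝ} (h0 : h nil = 0)
    (hh : ∀ l r, h (node () l r) = h l + h r + c l) (hc0 : ∀ t, 0 ≤ c t) (hc1 : ∀ t, c t ≤ 1) :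
    Tendsto (fun n : ℕ => treeSum h n / catalan n / n) atTop (𝓝 (criticalSum c / 2)) := by
  have hC : ∀ n, (0 : ℝ) < catalan n := fun n => Nat.cast_pos.2 (catalan_pos n)
  have hcs0 : ∀ n, 0 ≤ treeSum c n := fun n => sum_nonneg fun t _ => hc0 t
  have hcs1 : ∀ n, treeSum c n ≤ catalan n := fun n => by
    rw [← treeSum_one]
    exact sum_le_sum fun t _ => hc1 t
  set w : ℕ → ℝ := fun j => if j = 0 then 0 else (j.centralBinom : ℝ) with hw
  have hw0 : ∀ j, 0 ≤ w j := fun j => by simp only [hw]; split_ifs <;> positivity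
  -- For `n > 0`, the law of the left subtree size at a uniform node of a uniform tree with `n`
  -- nodes.
  set p : ℕ → ℕ → ℝ := fun n i =>
    if i ∈ range (n + 1) then catalan i * w (n - i) / (2 * (n * catalan n)) else 0 with hp
  have hsum : ∀ n i, i ∉ range (n + 1) → p n i = 0 := fun n i hi => by simp only [hp, if_neg hi]
  have hmain := tendsto_tsum_mul_of_hasSum_one (p := p) (a := fun i => catalan i / 4 ^ i / 2)
    (r := fun i => treeSum c i / catalan i) ?_ ?_ ?_ ?_ ?_ ?_
  · have h1 : ∑' i, (catalan i / 4 ^ i / 2 : ℝ) * (treeSum c i / catalan i) = criticalSum c / 2 := by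
      rw [criticalSum, ← tsum_div_const]
      congr 1
      ext i
      have := hC i
      field_simp
    rw [h1] at hmain
    refine hmain.congr fun n => ?_
    rw [tsum_eq_sum (s := range (n + 1)) fun i hi => by rw [hsum n i hi, zero_mul]]
    have h2 := two_mul_treeSum_of_additive h0 hh n
    rw [div_div, mul_comm (catalan n : ℝ), ← mul_div_mul_left _ _ (two_ne_zero' ℝ), h2, sum_div]
    refine sum_congr rfl fun i hi => ?_
    simp only [hp, if_pos hi]
    have := (hC i).ne'
    change _ = treeSum c i * w (n - i) / _
    field_simp
  · intro n i
    simp only [hp]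
    split_ifs
    · exact div_nonneg (mul_nonneg (hC i).le (hw0 _)) (by positivity)
    · exact le_rfl
  · intro i
    have h1 := (tendsto_centralBinom_sub_div i).mul
      ((tendsto_natCast_div_add_atTop (1 : ℝ)).inv₀ one_ne_zero)
    have h2 := (h1.const_mul (catalan i : ℝ)).div_const 2
    rw [inv_one, mul_one, mul_one_div] at h2
    refine h2.congr' ?_
    filter_upwards [eventually_gt_atTop i] with n hn
    have hB : ((n : ℝ) + 1) * catalan n = n.centralBinom := by
      exact_mod_cast succ_mul_catalan_eq_centralBinom n
    have hn0 : (n : ℝ) ≠ 0 := by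
      rw [Nat.cast_ne_zero]
      omega
    have hCn := (hC n).ne'
    simp only [hp, hw]
    rw [if_pos (by rw [mem_range]; omega), if_neg (by omega), ← hB]
    field_simp
  · have h1 := summable_catalan_div_four_pow.hasSum.div_const 2
    have h2 := criticalSum_one
    simp only [criticalSum, treeSum_one] at h2
    rwa [h2, div_self two_ne_zero] at h1
  · filter_upwards [eventually_gt_atTop 0] with n hn
    have h1 : ∑ i ∈ range (n + 1), p n i = 1 := by
      rw [sum_congr rfl fun i hi => by simp only [hp]; rw [if_pos hi], ← sum_div,
        ← two_mul_mul_catalan, div_self]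
      have := hC n
      positivity
    rw [← h1]
    exact hasSum_sum_of_ne_finset_zero (hsum n)
  · exact fun i => div_nonneg (hcs0 i) (hC i).le
  · exact fun i => (div_le_one (hC i)).2 (hcs1 i)

/-! ### The constant 3/7 -/

/-- Complete triples add up over the subtrees, and the root letter completes one more exactly when
the left subtree leaves two letters over. -/
lemma maxPrefix_node_div_three (l r : BinaryTree Unit) :
    maxPrefix (node () l r) / 3 =
      maxPrefix l / 3 + maxPrefix r / 3 + if maxPrefix l % 3 = 2 then 1 else 0 := by
  simp only [maxPrefix_node, max_def]
  split_ifs <;> omega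

open Topology in
lemma tendsto_mean_maxPrefix_div_three :
    Tendsto (fun n : ℕ => (∑ t ∈ treesOfNumNodesEq n, ((t.maxPrefix / 3 : ℕ) : ℝ)) / catalan n / n)
      atTop (𝓝 (1 / 7)) := by
  have h := tendsto_mean_of_additive (h := fun t => ((t.maxPrefix / 3 : ℕ) : ℝ))
    (c := ind fun t => maxPrefix t % 3 = 2) (by simp [maxPrefix])
    (fun l r => by simp [maxPrefix_node_div_three, ind])
    (fun t => by rw [ind]; split_ifs <;> simp) (fun t => by rw [ind]; split_ifs <;> simp)
  rw [criticalSum_maxPrefix_mod_three_eq_two] at h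
  norm_num at h ⊢
  exact h

end BinaryTree

open Topology in
lemma tendsto_avoidersExpectation_longestRepeat_div :
    Tendsto (fun n : ℕ => avoidersExpectation pattern132
        (fun σ : Equiv.Perm (Fin n) => (longestRepeat patternUUD σ : ℝ)) / n)
      atTop (𝓝 (3 / 7)) := by
  have h := BinaryTree.tendsto_mean_maxPrefix_div_three.const_mul 3
  rw [show (3 : ℝ) * (1 / 7) = 3 / 7 by norm_num] at h
  refine tendsto_of_tendsto_of_dist h ?_
  refine squeeze_zero (fun _ => dist_nonneg) (fun n => ?_)
    (tendsto_const_div_atTop_nhds_zero_nat (3 : ℝ))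
  rw [dist_comm, Real.dist_eq, ← mul_div_assoc, ← sub_div, abs_div, Nat.abs_cast]
  gcongr
  exact abs_avoidersExpectation_sub_le n

theorem theorem1 :
    (∀ (n : ℕ) (σ : Equiv.Perm (Fin n)), σ ∈ avoiders n pattern132 →
      longestRepeat patternUUD σ = 0 ∨ ∃ k : ℕ, 1 ≤ k ∧ longestRepeat patternUUD σ = 3 * k + 1) ∧
    (fun n : ℕ => avoidersExpectation pattern132
        (fun σ : Equiv.Perm (Fin n) => (longestRepeat patternUUD σ : ℝ)))
      ~[atTop] (fun n : ℕ => (3 / 7 : ℝ) * (n : ℝ)) := by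
  refine ⟨fun n σ _ => ?_, ?_⟩
  · rcases Equiv.Perm.longestRepeat_mem patternUUD σ with h | ⟨k, hk, h, -⟩
    · exact Or.inl h
    · exact Or.inr ⟨k, hk, by rw [h, mul_comm]⟩
  · rw [isEquivalent_iff_tendsto_one]
    · have := tendsto_avoidersExpectation_longestRepeat_div.div_const (3 / 7)
      rw [div_self (by norm_num)] at this
      refine this.congr fun n => ?_
      rw [Pi.div_apply, div_div, mul_comm]
    · filter_upwards [eventually_gt_atTop 0] with n hn
      positivity
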